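/- Let $Q$ be a closed connected smooth $n$-manifold and let $\Sigma_1,\dots,\Sigma_k\subset Q$ be a $\mathbb Z_2$-cut system, i.e. closed embedded smooth hypersurfaces in general position (near every point of $Q$ there is a smooth chart in which the hypersurfaces through that point are distinct coordinate hyperplanes) whose classes $[\Sigma_1],\dots,[\Sigma_k]$ form a basis of $H_{n-1}(Q;\mathbb Z_2)$. Choose tubular neighbourhoods of the $\Sigma_i$, i.e. open embeddings into $Q$ of Euclidean line bundles $E_i\to\Sigma_i$ that are the identity on the zero section, which are compatible: for $i\ne j$ and a point $y$ in the images of both $E_i$ and $E_j$, scaling $y$ in the fibre of $E_i$ does not leave the image of $E_j$ and does not change the fibre norm of $E_j$, and the fibrewise scalings of $E_i$ and $E_j$ commute at $y$. Let $N(\Sigma_i)$ be the image of the closed unit disc bundle of $E_i$, let $V=Q\setminus\bigcup_i \mathrm{int}\,N(\Sigma_i)$ be the resulting $\mathbb Z_2$-core of $Q$, with panels $P_i=V\cap\partial N(\Sigma_i)$, and let $\tau_i:P_i\to P_i$ be the free involution given by $v\mapsto -v$ in $E_i$ (the restriction of the deck transformation of the double cover $\partial N(\Sigma_i)\to\Sigma_i$);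 the $\tau_i$ preserve the sets $P_i\cap P_j$ and commute there. Let $\lambda:\{P_1,\dots,P_k\}\to(\mathbb Z_2)^m$ be any colouring, and let $$M(V,\lambda)=V\times(\mathbb Z_2)^m/\!\sim,$$ with the quotient topology, where $\sim$ is the equivalence relation generated by $(x,g)\sim(\tau_i(x),g+\lambda(P_i))$ for $x\in P_i$. Then the action $g\cdot[(x,g_0)]=[(x,g+g_0)]$ of $(\mathbb Z_2)^m$ on $M(V,\lambda)$ is free, $M(V,\lambda)$ is a closed $n$-manifold, and the orbit space $M(V,\lambda)/(\mathbb Z_2)^m$ is homeomorphic to $Q$. More precisely, $M(V,\lambda)$ is compact, Hausdorff and second countable, and there are a homeomorphism $h:M(V,\lambda)/(\mathbb Z_2)^m\to Q$ and a smooth structure on $M(V,\lambda)$ as an $n$-manifold without boundary such that $(\mathbb Z_2)^m$ acts by smooth maps and the composite of the orbit map with $h$ is a local diffeomorphism onto $Q$. -/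

import Mathlib

open scoped Manifold ContDiff
open CategoryTheory

universe u

/-! ### Mod 2 homology, fundamental classes and cut systems -/

/-- Singular homology `H_d(X; ℤ/2)`. -/
noncomputable abbrev Z2Homology (d : ℕ) (X : Type u) [TopologicalSpace X] :
    ModuleCat.{u} (ZMod 2) :=
  ((AlgebraicTopology.singularHomologyFunctor (ModuleCat.{u} (ZMod 2)) d).obj
    (ModuleCat.of (ZMod 2) (ULift.{u} (ZMod 2)))).obj (TopCat.of X)

/-- The linear map `H_d(A; ℤ/2) → H_d(X; ℤ/2)` induced by the inclusion of a subspace. -/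
noncomputable def Z2Homology.incl (d : ℕ) {X : Type u} [TopologicalSpace X] (A : Set X) :
    Z2Homology d A →ₗ[ZMod 2] Z2Homology d X :=
  (((AlgebraicTopology.singularHomologyFunctor (ModuleCat.{u} (ZMod 2)) d).obj
    (ModuleCat.of (ZMod 2) (ULift.{u} (ZMod 2)))).map
      (TopCat.ofHom ⟨((↑) : A → X), continuous_subtype_val⟩)).hom

/-- `α` is the mod 2 fundamental class of the closed `d`-manifold `X`: its image in the local
homology group `H_d(X, X ∖ {x}; ℤ/2) = ℤ/2` is nonzero for every `x`.  By the long exact sequence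
of the pair `(X, X ∖ {x})` this means that `α` does not come from `H_d(X ∖ {x}; ℤ/2)`. -/
def IsZ2FundamentalClass (d : ℕ) {X : Type u} [TopologicalSpace X] (α : Z2Homology d X) : Prop :=
  ∀ x : X, α ∉ LinearMap.range (Z2Homology.incl d ({x}ᶜ : Set X))

/-- The closed subsets `S i` of the smooth `n`-manifold `Q` are embedded hypersurfaces in general
position: every point `p` has a smooth chart in which those `S i` that pass through `p` are
pairwise distinct coordinate hyperplanes. -/
def IsGeneralPosition (n : ℕ) {Q : Type u} [TopologicalSpace Q]
    [ChartedSpace (EuclideanSpace ℝ (Fin n)) Q] {k : ℕ} (S : Fin k → Set Q) : Prop :=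
  (∀ i, IsClosed (S i)) ∧
  ∀ p : Q, ∃ φ ∈ IsManifold.maximalAtlas (𝓡 n) ∞ Q, p ∈ φ.source ∧
    ∃ c : {i : Fin k // p ∈ S i} ↪ Fin n,
      ∀ i, ∀ q ∈ φ.source, q ∈ S i.1 ↔ φ q (c i) = 0

/-- A `ℤ/2`-cut system of the closed smooth `n`-manifold `Q`: closed embedded hypersurfaces in
general position whose mod 2 homology classes form a basis of `H_{n-1}(Q; ℤ/2)`. -/
structure IsZ2CutSystem (n : ℕ) {Q : Type u} [TopologicalSpace Q]
    [ChartedSpace (EuclideanSpace ℝ (Fin n)) Q] {k : ℕ} (S : Fin k → Set Q) : Prop where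
  generalPosition : IsGeneralPosition n S
  basis : ∃ α : ∀ i, Z2Homology (n - 1) (S i), (∀ i, IsZ2FundamentalClass (n - 1) (α i)) ∧
    LinearIndependent (ZMod 2) (fun i => Z2Homology.incl (n - 1) (S i) (α i)) ∧
    Submodule.span (ZMod 2) (Set.range fun i => Z2Homology.incl (n - 1) (S i) (α i)) = ⊤

/-! ### Tubular neighbourhoods -/

/-- A tubular neighbourhood of a hypersurface `S ⊆ Q`: a real line bundle `E` over `S` with a
fibrewise Euclidean metric, and an open embedding of its total space into `Q` that restricts to the
identity on the zero section. The closed tubular neighbourhood `N(S)` is the image of the unit disc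
bundle. -/
structure LineTube {Q : Type u} [TopologicalSpace Q] (S : Set Q) where
  E : S → Type
  normed : ∀ x, NormedAddCommGroup (E x)
  inner : ∀ x, InnerProductSpace ℝ (E x)
  top : TopologicalSpace (Bundle.TotalSpace ℝ E)
  fiber : FiberBundle ℝ E
  vector : VectorBundle ℝ ℝ E
  riemannian : IsContinuousRiemannianBundle ℝ E
  emb : Bundle.TotalSpace ℝ E → Q
  isOpenEmbedding_emb : Topology.IsOpenEmbedding emb
  emb_zero : ∀ x : S, emb ⟨x, 0⟩ = x

attribute [instance] LineTube.normed LineTube.inner LineTube.top LineTube.fiber LineTube.vector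
  LineTube.riemannian

namespace LineTube

variable {Q : Type u} [TopologicalSpace Q] {S : Set Q} (T : LineTube S)

/-- The image of the total space of the line bundle. -/
def total : Set Q := Set.range T.emb

/-- The interior of `N(S)`: the image of the open unit disc bundle. -/
def interiorN : Set Q := T.emb '' {v | ‖v.2‖ < 1}

/-- The boundary of `N(S)`: the image of the unit sphere bundle, a double cover of `S`. -/
def boundaryN : Set Q := T.emb '' {v | ‖v.2‖ = 1}

open Classical in
/-- Multiplication by `t` in the fibres of the tubular neighbourhood (the identity outside). -/
noncomputable def scale (t : ℝ) (y : Q) : Q :=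
  if h : y ∈ T.total then T.emb ⟨h.choose.1, t • h.choose.2⟩ else y

open Classical in
/-- The distance to the zero section, measured in the fibres (irrelevant outside). -/
noncomputable def radius (y : Q) : ℝ :=
  if h : y ∈ T.total then ‖h.choose.2‖ else 0

theorem emb_mem (v) : T.emb v ∈ T.total := ⟨v, rfl⟩

theorem choose_emb (v) (h : T.emb v ∈ T.total) : h.choose = v :=
  T.isOpenEmbedding_emb.injective h.choose_spec

theorem scale_emb (t : ℝ) (v) : T.scale t (T.emb v) = T.emb ⟨v.1, t • v.2⟩ := by
  rw [scale, dif_pos (T.emb_mem v), T.choose_emb]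

theorem radius_emb (v) : T.radius (T.emb v) = ‖v.2‖ := by
  rw [radius, dif_pos (T.emb_mem v), T.choose_emb]

theorem scale_mem {y : Q} (t : ℝ) (hy : y ∈ T.total) : T.scale t y ∈ T.total := by
  obtain ⟨v, rfl⟩ := hy
  rw [scale_emb]; exact T.emb_mem _

theorem scale_of_notMem {y : Q} (t : ℝ) (hy : y ∉ T.total) : T.scale t y = y := dif_neg hy

theorem scale_scale (s t : ℝ) (y : Q) : T.scale s (T.scale t y) = T.scale (s * t) y := by
  by_cases hy : y ∈ T.total
  · obtain ⟨v, rfl⟩ := hy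
    simp only [scale_emb, mul_smul]
  · simp only [T.scale_of_notMem _ hy]

theorem scale_one (y : Q) : T.scale 1 y = y := by
  by_cases hy : y ∈ T.total
  · obtain ⟨v, rfl⟩ := hy
    simp only [scale_emb, one_smul]
  · exact T.scale_of_notMem _ hy

theorem mem_interiorN {y : Q} : y ∈ T.interiorN ↔ y ∈ T.total ∧ T.radius y < 1 := by
  constructor
  · rintro ⟨v, hv, rfl⟩
    exact ⟨T.emb_mem v, by rw [radius_emb]; exact hv⟩
  · rintro ⟨⟨v, rfl⟩, h⟩
    exact ⟨v, by rwa [radius_emb] at h, rfl⟩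

theorem mem_boundaryN {y : Q} : y ∈ T.boundaryN ↔ y ∈ T.total ∧ T.radius y = 1 := by
  constructor
  · rintro ⟨v, hv, rfl⟩
    exact ⟨T.emb_mem v, by rw [radius_emb]; exact hv⟩
  · rintro ⟨⟨v, rfl⟩, h⟩
    exact ⟨v, by rwa [radius_emb] at h, rfl⟩

theorem radius_neg (y : Q) : T.radius (T.scale (-1) y) = T.radius y := by
  by_cases hy : y ∈ T.total
  · obtain ⟨v, rfl⟩ := hy
    simp [scale_emb, radius_emb]
  · rw [T.scale_of_notMem _ hy]

theorem scale_neg_ne {y : Q} (hy : y ∈ T.boundaryN) : T.scale (-1) y ≠ y := by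
  obtain ⟨v, hv, rfl⟩ := hy
  rw [scale_emb]
  intro h
  have h1 := congrArg (fun w => (w : Bundle.TotalSpace ℝ T.E)) (T.isOpenEmbedding_emb.injective h)
  obtain ⟨x, w⟩ := v
  simp only [Bundle.TotalSpace.mk.injEq, heq_eq_eq, true_and, neg_smul, one_smul] at h1
  have h2 : (2 : ℝ) • w = 0 := by
    rw [two_smul]; nth_rewrite 1 [← h1]; exact neg_add_cancel w
  have h3 : w = 0 := (smul_eq_zero.1 h2).resolve_left two_ne_zero
  simp [h3] at hv

theorem continuous_neg :
    Continuous fun v : Bundle.TotalSpace ℝ T.E => (⟨v.1, (-1 : ℝ) • v.2⟩ : Bundle.TotalSpace ℝ T.E) := by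
  rw [continuous_iff_continuousAt]
  intro v
  rw [FiberBundle.continuousAt_totalSpace]
  refine ⟨(FiberBundle.continuous_proj ℝ T.E).continuousAt, ?_⟩
  have h1 : ContinuousAt (fun w : Bundle.TotalSpace ℝ T.E =>
      (trivializationAt ℝ T.E v.1 w).2) v :=
    ((FiberBundle.continuousAt_totalSpace ℝ (fun w : Bundle.TotalSpace ℝ T.E => w)).1
      continuousAt_id).2
  refine (h1.const_smul (-1 : ℝ)).congr ?_
  have hb : v.1 ∈ (trivializationAt ℝ T.E v.1).baseSet := FiberBundle.mem_baseSet_trivializationAt' v.1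
  have := (FiberBundle.continuous_proj ℝ T.E).continuousAt.preimage_mem_nhds (x := v)
    ((trivializationAt ℝ T.E v.1).open_baseSet.mem_nhds hb)
  filter_upwards [this] with w hw
  exact (((trivializationAt ℝ T.E v.1).linear ℝ hw).map_smul (-1 : ℝ) w.2).symm

theorem continuousOn_scale_neg : ContinuousOn (T.scale (-1)) T.total := by
  rw [continuousOn_iff_continuous_domRestrict]
  have h : T.total.domRestrict (T.scale (-1)) = fun y : T.total => T.emb
      ⟨(T.isOpenEmbedding_emb.isEmbedding.toHomeomorph.symm y).1,
        (-1 : ℝ) • (T.isOpenEmbedding_emb.isEmbedding.toHomeomorph.symm y).2⟩ := by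
    funext y
    obtain ⟨v, hv⟩ := T.isOpenEmbedding_emb.isEmbedding.toHomeomorph.surjective y
    subst hv
    rw [Homeomorph.symm_apply_apply]
    exact T.scale_emb (-1) v
  rw [h]
  exact T.isOpenEmbedding_emb.continuous.comp (T.continuous_neg.comp (Homeomorph.continuous _))

theorem isOpen_total : IsOpen T.total := T.isOpenEmbedding_emb.isOpen_range

end LineTube

/-! ### Spaces with involutive panels and the glue-back construction -/

/-- Panels `P i` in a space `W`, with involutions `τ i : P i → P i` which preserve the
intersections of panels and commute there. -/
structure InvolutivePanels (W : Type u) [TopologicalSpace W] (ι : Type) where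
  panel : ι → Set W
  tau : ∀ i, panel i ≃ₜ panel i
  tau_tau : ∀ i x, tau i (tau i x) = x
  tau_mem : ∀ i j (x : panel i), (x : W) ∈ panel j → (tau i x : W) ∈ panel j
  tau_comm : ∀ i j x (hi : x ∈ panel i) (hj : x ∈ panel j),
    (tau i ⟨tau j ⟨x, hj⟩, tau_mem j i _ hi⟩ : W) = tau j ⟨tau i ⟨x, hi⟩, tau_mem i j _ hj⟩

section GlueBack

variable {W : Type u} [TopologicalSpace W] {ι : Type} (P : InvolutivePanels W ι)
  {m : ℕ} (col : ι → Fin m → ZMod 2)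

/-- The gluing rule: `(x, g) ∼ (τ i x, g + col i)` for `x ∈ P i`. -/
def GlueBackRel (a b : W × (Fin m → ZMod 2)) : Prop :=
  ∃ i, ∃ h : a.1 ∈ P.panel i, b.1 = P.tau i ⟨a.1, h⟩ ∧ b.2 = a.2 + col i

/-- The glue-back space `M(W, {P i, τ i}, col)`: the quotient of `W × (ℤ/2)^m` by the equivalence
relation generated by the gluing rule. -/
def GlueBack : Type u := Quot (GlueBackRel P col)

namespace GlueBack

/-- The class `[(x, g)]`. -/
def mk (x : W) (g : Fin m → ZMod 2) : GlueBack P col := Quot.mk _ (x, g)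

/-- The quotient topology, where `(ℤ/2)^m` is discrete. -/
instance : TopologicalSpace (GlueBack P col) :=
  TopologicalSpace.coinduced (fun a : W × (Fin m → ZMod 2) => mk P col a.1 a.2)
    (@instTopologicalSpaceProd _ _ inferInstance ⊥)

/-- The natural action `g • [(x, g₀)] = [(x, g + g₀)]`. -/
instance : AddAction (Fin m → ZMod 2) (GlueBack P col) where
  vadd g := Quot.map (fun a => (a.1, g + a.2)) (by
    rintro a b ⟨i, h, h1, h2⟩
    exact ⟨i, h, h1, by simp only [h2, add_assoc]⟩)
  zero_vadd := by
    rintro ⟨x, g⟩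
    exact congrArg (Quot.mk _) (Prod.ext rfl (zero_add g))
  add_vadd := by
    rintro g g' ⟨x, g''⟩
    exact congrArg (Quot.mk _) (Prod.ext rfl (add_assoc g g' g''))

theorem vadd_mk (g g₀ : Fin m → ZMod 2) (x : W) : g +ᵥ mk P col x g₀ = mk P col x (g + g₀) := rfl

end GlueBack

end GlueBack

/-! ### The core of a closed manifold -/

/-- Tubular neighbourhoods of the hypersurfaces `S i` that are compatible with each other: the
fibres of one tubular neighbourhood that meet another one are contained in it at constant distance
from its zero section, and the fibrewise scalings commute. -/
structure TubeSystem {Q : Type u} [TopologicalSpace Q] {k : ℕ} (S : Fin k → Set Q) where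
  tube : ∀ i, LineTube (S i)
  scale_mem : ∀ i j, i ≠ j → ∀ y ∈ (tube i).total ∩ (tube j).total, ∀ t : ℝ,
    (tube i).scale t y ∈ (tube j).total
  radius_scale : ∀ i j, i ≠ j → ∀ y ∈ (tube i).total ∩ (tube j).total, ∀ t : ℝ,
    (tube j).radius ((tube i).scale t y) = (tube j).radius y
  scale_comm : ∀ i j, i ≠ j → ∀ y ∈ (tube i).total ∩ (tube j).total, ∀ s t : ℝ,
    (tube i).scale s ((tube j).scale t y) = (tube j).scale t ((tube i).scale s y)

namespace TubeSystem

variable {Q : Type u} [TopologicalSpace Q] {k : ℕ} {S : Fin k → Set Q} (T : TubeSystem S)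

/-- The core `V`: the complement in `Q` of the interiors of the tubular neighbourhoods. -/
def core : Set Q := (⋃ i, (T.tube i).interiorN)ᶜ

/-- The involution of the boundary of the `i`-th tubular neighbourhood, extended to `Q`. -/
noncomputable def flip (i : Fin k) (y : Q) : Q := (T.tube i).scale (-1) y

theorem flip_flip (i : Fin k) (y : Q) : T.flip i (T.flip i y) = y := by
  rw [flip, flip, LineTube.scale_scale]; norm_num [LineTube.scale_one]

theorem flip_mem_total (i j : Fin k) (y : Q) (hy : y ∈ (T.tube i).total)
    (h : y ∈ (T.tube j).total) : T.flip i y ∈ (T.tube j).total := by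
  by_cases hij : i = j
  · subst hij; exact (T.tube i).scale_mem _ hy
  · exact T.scale_mem i j hij y ⟨hy, h⟩ _

theorem flip_mem_total_iff (i j : Fin k) (y : Q) (hy : y ∈ (T.tube i).total) :
    T.flip i y ∈ (T.tube j).total ↔ y ∈ (T.tube j).total := by
  refine ⟨fun h => ?_, T.flip_mem_total i j y hy⟩
  have h' : T.flip i (T.flip i y) ∈ (T.tube j).total :=
    T.flip_mem_total i j _ ((T.tube i).scale_mem _ hy) h
  rwa [flip_flip] at h'

theorem radius_flip (i j : Fin k) (y : Q) (hy : y ∈ (T.tube i).total)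
    (h : y ∈ (T.tube j).total) : (T.tube j).radius (T.flip i y) = (T.tube j).radius y := by
  by_cases hij : i = j
  · subst hij; exact (T.tube i).radius_neg y
  · exact T.radius_scale i j hij y ⟨hy, h⟩ _

theorem flip_mem_boundaryN (i j : Fin k) (y : Q) (hy : y ∈ (T.tube i).total)
    (h : y ∈ (T.tube j).boundaryN) : T.flip i y ∈ (T.tube j).boundaryN := by
  rw [LineTube.mem_boundaryN] at h ⊢
  rw [T.flip_mem_total_iff i j y hy, T.radius_flip i j y hy h.1]
  exact h

theorem flip_mem_core (i : Fin k) (y : Q) (hy : y ∈ (T.tube i).total) (h : y ∈ T.core) :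
    T.flip i y ∈ T.core := by
  simp only [core, Set.mem_compl_iff, Set.mem_iUnion, not_exists, LineTube.mem_interiorN] at h ⊢
  intro j hj
  have h1 := (T.flip_mem_total_iff i j y hy).1 hj.1
  exact h j ⟨h1, by rw [← T.radius_flip i j y hy h1]; exact hj.2⟩

theorem flip_comm (i j : Fin k) (y : Q) (hi : y ∈ (T.tube i).total)
    (hj : y ∈ (T.tube j).total) : T.flip i (T.flip j y) = T.flip j (T.flip i y) := by
  by_cases hij : i = j
  · subst hij; rfl
  · exact T.scale_comm i j hij y ⟨hi, hj⟩ _ _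

theorem mem_total_of_boundaryN {i : Fin k} {y : Q} (h : y ∈ (T.tube i).boundaryN) :
    y ∈ (T.tube i).total := ((T.tube i).mem_boundaryN.1 h).1

/-- The panel of the core in the boundary of the `i`-th tubular neighbourhood. -/
def panel (i : Fin k) : Set T.core := {x | (x : Q) ∈ (T.tube i).boundaryN}

/-- The restriction of the involution to the panel. -/
noncomputable def tauFun (i : Fin k) (x : T.panel i) : T.panel i :=
  ⟨⟨T.flip i x, T.flip_mem_core i _ (T.mem_total_of_boundaryN x.2) x.1.2⟩,
    T.flip_mem_boundaryN i i _ (T.mem_total_of_boundaryN x.2) x.2⟩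

theorem tauFun_tauFun (i : Fin k) (x : T.panel i) : T.tauFun i (T.tauFun i x) = x :=
  Subtype.ext (Subtype.ext (T.flip_flip i x))

theorem continuous_tauFun (i : Fin k) : Continuous (T.tauFun i) := by
  refine Continuous.subtype_mk (Continuous.subtype_mk ?_ _) _
  exact (T.tube i).continuousOn_scale_neg.comp_continuous
    (continuous_subtype_val.comp continuous_subtype_val) fun x => T.mem_total_of_boundaryN x.2

/-- The involutions are free. -/
theorem tauFun_ne (i : Fin k) (x : T.panel i) : T.tauFun i x ≠ x := fun h =>
  (T.tube i).scale_neg_ne x.2 (congrArg (fun y : T.panel i => (y : Q)) h)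

/-- The involutive panel structure `{P i, τ i}` on the core. -/
noncomputable def panels : InvolutivePanels T.core (Fin k) where
  panel := T.panel
  tau i :=
    { toFun := T.tauFun i
      invFun := T.tauFun i
      left_inv := T.tauFun_tauFun i
      right_inv := T.tauFun_tauFun i
      continuous_toFun := T.continuous_tauFun i
      continuous_invFun := T.continuous_tauFun i }
  tau_tau := T.tauFun_tauFun
  tau_mem i j x h := T.flip_mem_boundaryN i j _ (T.mem_total_of_boundaryN x.2) h
  tau_comm i j x hi hj := Subtype.ext
    (T.flip_comm i j x (T.mem_total_of_boundaryN hi) (T.mem_total_of_boundaryN hj))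

end TubeSystem

/-! Collapsing each `N(Σ_i)` along its fibres onto `Σ_i`, and stretching the vectors of length
between 1 and 2 to compensate, gives a continuous map `c_i : Q → Q`. Off the interior of `N(Σ_i)` it
is surjective and identifies nothing but `v` with `-v` on the unit sphere bundle
(`LineTube.eq_or_eq_of_collapse_eq`, `LineTube.exists_collapse_eq`). Compatibility of the tubes lets
the composite of all `c_i` be analysed one factor at a time: it maps the core onto `Q` and
identifies exactly the points related by the `τ_i`. It therefore induces a map `M(V,λ) → Q` whose
fibres are the orbits (`projection_eq_iff`).

Freeness is a parity argument. If `(x, g) ∼ (x, g')`, some word in the `τ_i` fixes `x`, and `g' - g`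
is the sum of its colours. Projecting to the zero section of every tube except the `i`-th kills all
letters but `τ_i`, which moves every point of its sphere bundle. So each letter occurs an even
number of times (`even_count_of_flips_eq`) and the colours cancel mod 2.

`M(V,λ)` is Hausdorff because the gluing map is closed: finitely many commuting involutions on
closed panels saturate closed sets to closed sets. A free action of a finite group on a compact
Hausdorff space makes `M(V,λ) → Q` a covering. The smooth structure is pulled back from `Q`, so no
corners of the core need smoothing, and the group acts smoothly because it acts by lifts of the
projection. -/

/-! ### Pulling back a smooth structure along a local homeomorphism -/

section PullbackManifold

variable {𝕜 E H M N : Type*} [NontriviallyNormedField 𝕜] [NormedAddCommGroup E] [NormedSpace 𝕜 E]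
  [TopologicalSpace H] [TopologicalSpace M] [TopologicalSpace N] [ChartedSpace H N] {f : M → N}

/-- The charted space structure pulled back along a local homeomorphism: its charts are the
composites of the local restrictions of `f` with the charts of the target. -/
@[reducible]
noncomputable def IsLocalHomeomorph.pullbackChartedSpace (hf : IsLocalHomeomorph f) :
    ChartedSpace H M where
  atlas := {φ | ∃ e : OpenPartialHomeomorph M N, f = e ∧ ∃ c ∈ atlas H N, φ = e.trans c}
  chartAt x := (hf x).choose.trans (chartAt H (f x))
  mem_chart_source x := by
    have h := (hf x).choose_spec
    rw [OpenPartialHomeomorph.trans_source]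
    refine ⟨h.1, ?_⟩
    rw [Set.mem_preimage, ← h.2]
    exact mem_chart_source H (f x)
  chart_mem_atlas x := ⟨_, (hf x).choose_spec.2, _, chart_mem_atlas H _, rfl⟩

/-- The local restrictions `e`, `e'` of the one map `f` cancel in a change of charts: `e' ∘ e.symm`
is the identity where defined. Every transition map is thus a restriction of one of `N`. -/
theorem IsLocalHomeomorph.isManifold_pullback (hf : IsLocalHomeomorph f)
    (I : ModelWithCorners 𝕜 E H) (n : WithTop ℕ∞) [IsManifold I n N] :
    letI := hf.pullbackChartedSpace (H := H)
    IsManifold I n M := by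
  let := hf.pullbackChartedSpace (H := H)
  apply isManifold_of_contDiffOn
  rintro _ _ ⟨e, he, c, hc, rfl⟩ ⟨e', he', c', hc', rfl⟩
  have key : ∀ x ∈ ((e.trans c).symm.trans (e'.trans c')).source,
      x ∈ (c.symm.trans c').source ∧
        ((e.trans c).symm.trans (e'.trans c')) x = (c.symm.trans c') x := by
    intro x hx
    simp only [OpenPartialHomeomorph.trans_source, OpenPartialHomeomorph.symm_source,
      OpenPartialHomeomorph.trans_target, Set.mem_inter_iff, Set.mem_preimage,
      OpenPartialHomeomorph.coe_trans_symm, Function.comp_apply] at hx ⊢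
    have h1 : e' (e.symm (c.symm x)) = c.symm x := by
      rw [← he', he]
      exact e.right_inv hx.1.2
    refine ⟨⟨hx.1.1, h1 ▸ hx.2.2⟩, ?_⟩
    simp [h1]
  have h2 := (contDiffGroupoid n I).compatible hc hc'
  rw [contDiffGroupoid, mem_groupoid_of_pregroupoid] at h2
  refine (h2.1.mono ?_).congr ?_
  · rintro y ⟨hy, hy'⟩
    exact ⟨(key _ hy).1, hy'⟩
  · rintro y ⟨hy, -⟩
    exact congrArg I (key _ hy).2

/-- Read in the charts `e.trans c` and `c`, the map `f` is the identity; both `e` and its inverse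
are locally a chart followed by an inverse chart. -/
theorem IsLocalHomeomorph.isLocalDiffeomorph_pullback (hf : IsLocalHomeomorph f)
    (I : ModelWithCorners 𝕜 E H) (n : WithTop ℕ∞) [IsManifold I n N] :
    letI := hf.pullbackChartedSpace (H := H)
    IsLocalDiffeomorph I I n f := by
  let := hf.pullbackChartedSpace (H := H)
  have := hf.isManifold_pullback I n
  intro x
  obtain ⟨e, hx, he⟩ := hf x
  have hφ : ∀ c ∈ atlas H N, e.trans c ∈ IsManifold.maximalAtlas I n M := fun c hc =>
    IsManifold.subset_maximalAtlas ⟨e, he, c, hc, rfl⟩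
  refine ⟨⟨e.toPartialEquiv, e.open_source, e.open_target, ?_, ?_⟩, hx, fun y _ => congrFun he y⟩
  · intro y hy
    refine ContMDiffAt.contMDiffWithinAt ?_
    have hc := chart_mem_atlas H (e y)
    have hy' : y ∈ (e.trans (chartAt H (e y))).source :=
      ⟨hy, mem_chart_source H (e y)⟩
    have h1 := (contMDiffOn_of_mem_maximalAtlas (hφ _ hc)).contMDiffAt
      ((e.trans (chartAt H (e y))).open_source.mem_nhds hy')
    have h2 := (contMDiffOn_symm_of_mem_maximalAtlas
      (IsManifold.subset_maximalAtlas (I := I) (n := n) hc)).contMDiffAt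
      ((chartAt H (e y)).open_target.mem_nhds (mem_chart_target H (e y)))
    refine (ContMDiffAt.comp y h2 h1).congr_of_eventuallyEq ?_
    filter_upwards [(e.trans (chartAt H (e y))).open_source.mem_nhds hy'] with z hz
    exact ((chartAt H (e y)).left_inv hz.2).symm
  · intro y hy
    refine ContMDiffAt.contMDiffWithinAt ?_
    have hc := chart_mem_atlas H y
    have hy' : chartAt H y y ∈ (e.trans (chartAt H y)).target :=
      ⟨mem_chart_target H y, by
        simpa [(chartAt H y).left_inv (mem_chart_source H y)] using hy⟩
    have h1 := (contMDiffOn_of_mem_maximalAtlas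
      (IsManifold.subset_maximalAtlas (I := I) (n := n) hc)).contMDiffAt
      ((chartAt H y).open_source.mem_nhds (mem_chart_source H y))
    have h2 := (contMDiffOn_symm_of_mem_maximalAtlas (hφ _ hc)).contMDiffAt
      ((e.trans (chartAt H y)).open_target.mem_nhds hy')
    refine (ContMDiffAt.comp y h2 h1).congr_of_eventuallyEq ?_
    filter_upwards [(chartAt H y).open_source.mem_nhds (mem_chart_source H y)] with z hz
    exact congrArg e.symm ((chartAt H y).left_inv hz).symm

/-- A continuous lift of a smooth map through a local diffeomorphism is smooth. -/
theorem IsLocalDiffeomorph.contMDiff_of_comp {P : Type*} [TopologicalSpace P] [ChartedSpace H M]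
    [ChartedSpace H P] {I : ModelWithCorners 𝕜 E H} {n : WithTop ℕ∞}
    (hf : IsLocalDiffeomorph I I n f) {g : P → M} (hg : Continuous g)
    (h : ContMDiff I I n (f ∘ g)) : ContMDiff I I n g := by
  intro x
  have hfx := hf (g x)
  have h1 := (hfx.contmdiffOn_localInverse.contMDiffAt
    (hfx.localInverse_open_source.mem_nhds hfx.localInverse_mem_source))
  refine (ContMDiffAt.comp x h1 (h x)).congr_of_eventuallyEq ?_
  filter_upwards [hg.continuousAt.eventually hfx.localInverse_eventuallyEq_left] with z hz
  exact hz.symm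

end PullbackManifold

/-! ### Norm, scaling and compact disc bundles in one tube -/

namespace LineTube

variable {Q : Type u} [TopologicalSpace Q] {S : Set Q} (T : LineTube S)

theorem continuous_norm_totalSpace :
    Continuous fun v : Bundle.TotalSpace ℝ T.E => ‖v.2‖ := by
  have h : Continuous fun v : Bundle.TotalSpace ℝ T.E => Inner.inner ℝ v.2 v.2 :=
    Continuous.inner_bundle (F := ℝ) (E := T.E) (b := fun v : Bundle.TotalSpace ℝ T.E => v.1)
      (v := fun v => v.2) (w := fun v => v.2) continuous_id continuous_id
  simp only [norm_eq_sqrt_real_inner]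
  exact Real.continuous_sqrt.comp h

theorem continuous_smul_totalSpace {a : Bundle.TotalSpace ℝ T.E → ℝ} (ha : Continuous a) :
    Continuous fun v : Bundle.TotalSpace ℝ T.E =>
      (⟨v.1, a v • v.2⟩ : Bundle.TotalSpace ℝ T.E) := by
  rw [continuous_iff_continuousAt]
  intro v
  rw [FiberBundle.continuousAt_totalSpace]
  refine ⟨(FiberBundle.continuous_proj ℝ T.E).continuousAt, ?_⟩
  have h1 : ContinuousAt (fun w : Bundle.TotalSpace ℝ T.E =>
      (trivializationAt ℝ T.E v.1 w).2) v :=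
    ((FiberBundle.continuousAt_totalSpace ℝ (fun w : Bundle.TotalSpace ℝ T.E => w)).1
      continuousAt_id).2
  refine (ha.continuousAt.smul h1).congr ?_
  have hb : v.1 ∈ (trivializationAt ℝ T.E v.1).baseSet :=
    FiberBundle.mem_baseSet_trivializationAt' v.1
  filter_upwards [(FiberBundle.continuous_proj ℝ T.E).continuousAt.preimage_mem_nhds (x := v)
    ((trivializationAt ℝ T.E v.1).open_baseSet.mem_nhds hb)] with w hw
  exact (((trivializationAt ℝ T.E v.1).linear ℝ hw).map_smul (a w) w.2).symm

/-- Near `x` the trivialization has fibrewise operator norm below some `C`, so the `R`-discs land in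
the compact ball of radius `C * R`. -/
theorem exists_isCompact_discBundle_subset [LocallyCompactSpace S] (R : ℝ) (x : S) :
    ∃ U ∈ nhds x, ∃ K : Set (Bundle.TotalSpace ℝ T.E), IsCompact K ∧
      {v : Bundle.TotalSpace ℝ T.E | v.1 ∈ U ∧ ‖v.2‖ ≤ R} ⊆ K := by
  obtain ⟨C, hC, hev⟩ := eventually_norm_trivializationAt_lt ℝ T.E x
  set e := trivializationAt ℝ T.E x with he
  have hx : e.baseSet ∈ nhds x :=
    e.open_baseSet.mem_nhds (FiberBundle.mem_baseSet_trivializationAt' x)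
  obtain ⟨U, hU, hUe, hUc⟩ := local_compact_nhds (Filter.inter_mem hx hev)
  refine ⟨U, hU, e.toOpenPartialHomeomorph.symm '' (U ×ˢ Metric.closedBall 0 (C * R)), ?_, ?_⟩
  · refine (hUc.prod (isCompact_closedBall _ _)).image_of_continuousOn
      (e.toOpenPartialHomeomorph.continuousOn_symm.mono ?_)
    rintro ⟨y, t⟩ ⟨hy, -⟩
    exact e.mem_target.2 (hUe hy).1
  · rintro v ⟨hv, hR⟩
    have hb := (hUe hv).1
    have hs : v ∈ e.source := e.mem_source.2 hb
    refine ⟨e v, ⟨?_, ?_⟩, e.toOpenPartialHomeomorph.left_inv hs⟩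
    · rw [e.coe_fst hs]; exact hv
    · have h1 : e.continuousLinearMapAt ℝ v.1 v.2 = (e v).2 := by
        rw [Bundle.Trivialization.continuousLinearMapAt_apply, e.coe_linearMapAt_of_mem hb]
      rw [mem_closedBall_zero_iff, ← h1]
      refine (ContinuousLinearMap.le_opNorm _ _).trans ?_
      exact mul_le_mul (hUe hv).2.le hR (norm_nonneg _) hC.le

theorem isCompact_discBundle [CompactSpace S] [LocallyCompactSpace S] (R : ℝ) :
    IsCompact {v : Bundle.TotalSpace ℝ T.E | ‖v.2‖ ≤ R} := by
  choose U hU K hK hUK using T.exists_isCompact_discBundle_subset R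
  obtain ⟨t, ht⟩ := isCompact_univ.elim_nhds_subcover U fun x _ => hU x
  refine (t.isCompact_biUnion fun x _ => hK x).of_isClosed_subset
    (isClosed_le T.continuous_norm_totalSpace continuous_const) fun v hv => ?_
  obtain ⟨x, hx, hvx⟩ := Set.mem_iUnion₂.1 (ht.2 (Set.mem_univ v.1))
  exact Set.mem_biUnion hx (hUK x ⟨hvx, hv⟩)

theorem isClosed_image_discBundle [T2Space Q] [CompactSpace S] (R : ℝ) :
    IsClosed (T.emb '' {v | ‖v.2‖ ≤ R}) :=
  ((T.isCompact_discBundle R).image T.isOpenEmbedding_emb.continuous).isClosed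

theorem isClosed_boundaryN [T2Space Q] [CompactSpace S] : IsClosed T.boundaryN :=
  (((T.isCompact_discBundle 1).of_isClosed_subset
    (isClosed_eq T.continuous_norm_totalSpace continuous_const) fun _ h => le_of_eq h).image
      T.isOpenEmbedding_emb.continuous).isClosed

theorem isOpen_interiorN : IsOpen T.interiorN :=
  T.isOpenEmbedding_emb.isOpenMap _ (isOpen_lt T.continuous_norm_totalSpace continuous_const)

theorem radius_of_notMem {y : Q} (hy : y ∉ T.total) : T.radius y = 0 := dif_neg hy

theorem scale_mem_iff {y : Q} (t : ℝ) : T.scale t y ∈ T.total ↔ y ∈ T.total := by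
  refine ⟨fun h => ?_, T.scale_mem t⟩
  by_contra hy
  exact hy (T.scale_of_notMem t hy ▸ h)

theorem radius_scale_self (t : ℝ) (y : Q) : T.radius (T.scale t y) = |t| * T.radius y := by
  by_cases hy : y ∈ T.total
  · obtain ⟨v, rfl⟩ := hy
    rw [scale_emb, radius_emb, radius_emb, norm_smul, Real.norm_eq_abs]
  · rw [T.scale_of_notMem _ hy, T.radius_of_notMem hy, mul_zero]

theorem continuous_scale_emb (v : Bundle.TotalSpace ℝ T.E) :
    Continuous fun t : ℝ => T.scale t (T.emb v) := by
  simp only [scale_emb]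
  refine T.isOpenEmbedding_emb.continuous.comp ?_
  rw [continuous_iff_continuousAt]
  intro t
  rw [FiberBundle.continuousAt_totalSpace]
  refine ⟨continuousAt_const, ?_⟩
  have hb : v.1 ∈ (trivializationAt ℝ T.E v.1).baseSet :=
    FiberBundle.mem_baseSet_trivializationAt' v.1
  have h : (fun s : ℝ => (trivializationAt ℝ T.E v.1 (⟨v.1, s • v.2⟩ : Bundle.TotalSpace ℝ T.E)).2) =
      fun s => s • (trivializationAt ℝ T.E v.1 v).2 := by
    funext s
    exact ((trivializationAt ℝ T.E v.1).linear ℝ hb).map_smul s v.2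
  exact (h ▸ (continuous_id.smul continuous_const) : Continuous _).continuousAt

/-- Two vectors of the same length in a fibre of the line bundle agree up to sign. -/
theorem eq_or_eq_neg_of_norm_eq {x : S} {v w : T.E x} (h : ‖v‖ = ‖w‖) : w = v ∨ w = -v := by
  by_cases hv : v = 0
  · subst hv
    left
    rw [norm_zero] at h
    exact norm_eq_zero.1 h.symm
  · have hb : x ∈ (trivializationAt ℝ T.E x).baseSet := FiberBundle.mem_baseSet_trivializationAt' x
    have h1 : Module.finrank ℝ (T.E x) = 1 := by
      rw [((trivializationAt ℝ T.E x).linearEquivAt ℝ x hb).finrank_eq, Module.finrank_self]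
    obtain ⟨c, rfl⟩ := (finrank_eq_one_iff_of_nonzero' v hv).1 h1 w
    rw [norm_smul, eq_comm, mul_eq_right₀ (norm_ne_zero_iff.2 hv), Real.norm_eq_abs] at h
    rcases eq_or_eq_neg_of_abs_eq h with rfl | rfl
    · left; rw [one_smul]
    · right; rw [neg_smul, one_smul]

theorem exists_norm_eq_one (x : S) : ∃ v : T.E x, ‖v‖ = 1 := by
  have hb : x ∈ (trivializationAt ℝ T.E x).baseSet := FiberBundle.mem_baseSet_trivializationAt' x
  have : Nontrivial (T.E x) :=
    ((trivializationAt ℝ T.E x).linearEquivAt ℝ x hb).toEquiv.nontrivial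
  exact exists_norm_eq _ zero_le_one

/-! #### The collapse of a tubular neighbourhood -/

/-- The factor by which vectors of length `r` are scaled by the collapse. -/
noncomputable def collapseFactor (r : ℝ) : ℝ := max 0 (min 1 (r - 1))

theorem continuous_collapseFactor : Continuous collapseFactor := by
  unfold collapseFactor; fun_prop

theorem collapseFactor_nonneg (r : ℝ) : 0 ≤ collapseFactor r := le_max_left _ _

theorem collapseFactor_of_two_le {r : ℝ} (h : 2 ≤ r) : collapseFactor r = 1 := by
  rw [collapseFactor, min_eq_left (by linarith), max_eq_right zero_le_one]

theorem collapseFactor_one : collapseFactor 1 = 0 := by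
  simp [collapseFactor]

theorem collapseFactor_pos {r : ℝ} (h : 1 < r) : 0 < collapseFactor r :=
  lt_max_of_lt_right (lt_min one_pos (by linarith))

theorem collapseFactor_mono : Monotone collapseFactor := fun _ _ h =>
  max_le_max le_rfl (min_le_min le_rfl (by linarith))

theorem strictMonoOn_collapseFactor_mul :
    StrictMonoOn (fun r => collapseFactor r * r) (Set.Ici 1) := by
  intro r hr s hs h
  have h1 : 0 < collapseFactor s := collapseFactor_pos (lt_of_le_of_lt hr h)
  have h2 : collapseFactor r ≤ collapseFactor s := collapseFactor_mono h.le
  have h0 : (0 : ℝ) ≤ r := zero_le_one.trans hr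
  exact (mul_le_mul_of_nonneg_right h2 h0).trans_lt (mul_lt_mul_of_pos_left h h1)

theorem exists_collapseFactor_mul_eq {s : ℝ} (hs : 0 ≤ s) :
    ∃ r, 1 ≤ r ∧ collapseFactor r * r = s := by
  -- Beyond 2 the factor is 1, so the right endpoint `max 2 s` is mapped to itself and the
  -- intermediate value theorem reaches `s`.
  have h1 : (1 : ℝ) ≤ max 2 s := one_le_two.trans (le_max_left _ _)
  have hc : ContinuousOn (fun r => collapseFactor r * r) (Set.Icc 1 (max 2 s)) :=
    (continuous_collapseFactor.mul continuous_id).continuousOn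
  obtain ⟨r, hr, h⟩ := intermediate_value_Icc h1 hc
    (show s ∈ Set.Icc _ _ by
      simp only [collapseFactor_one, zero_mul, collapseFactor_of_two_le (le_max_left 2 s), one_mul]
      exact ⟨hs, le_max_right _ _⟩)
  exact ⟨r, hr.1, h⟩

/-- The map which shrinks `N(S)` to `S` along the fibres, stretches the vectors of length
between `1` and `2` accordingly, and is the identity elsewhere. -/
noncomputable def collapse (y : Q) : Q := T.scale (collapseFactor (T.radius y)) y

/-- The only delicate points lie outside the open tube. The disc bundle of radius 2 has compact,
hence closed, image, and off that image the collapse is the identity. -/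
theorem continuous_collapse [T2Space Q] [CompactSpace S] : Continuous T.collapse := by
  rw [continuous_iff_continuousAt]
  intro y
  by_cases hy : y ∈ T.total
  · obtain ⟨v, rfl⟩ := hy
    rw [← T.isOpenEmbedding_emb.continuousAt_iff]
    have h : T.collapse ∘ T.emb = fun w => T.emb ⟨w.1, collapseFactor ‖w.2‖ • w.2⟩ := by
      funext w
      simp only [Function.comp_apply, collapse, radius_emb, scale_emb]
    rw [h]
    exact (T.isOpenEmbedding_emb.continuous.comp (T.continuous_smul_totalSpace
      (continuous_collapseFactor.comp T.continuous_norm_totalSpace))).continuousAt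
  · have hmem : y ∈ (T.emb '' {v | ‖v.2‖ ≤ 2})ᶜ := fun ⟨v, _, hv⟩ => hy ⟨v, hv⟩
    refine continuousAt_id.congr ?_
    filter_upwards [(T.isClosed_image_discBundle 2).isOpen_compl.mem_nhds hmem] with z hz
    by_cases hzt : z ∈ T.total
    · obtain ⟨v, rfl⟩ := hzt
      have hv : 2 ≤ ‖v.2‖ := by
        by_contra h
        exact hz ⟨v, (not_le.1 h).le, rfl⟩
      rw [collapse, radius_emb, collapseFactor_of_two_le hv, scale_one, id]
    · rw [collapse, T.scale_of_notMem _ hzt, id]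

theorem collapse_mem_iff {y : Q} : T.collapse y ∈ T.total ↔ y ∈ T.total := T.scale_mem_iff _

/-- The fibres of the collapse of the complement of the open tubular neighbourhood. -/
theorem eq_or_eq_of_collapse_eq {y z : Q} (hy : y ∉ T.interiorN) (hz : z ∉ T.interiorN)
    (h : T.collapse y = T.collapse z) :
    z = y ∨ y ∈ T.boundaryN ∧ z = T.scale (-1) y := by
  by_cases hyt : y ∈ T.total
  swap
  · have hzt : z ∉ T.total := fun hzt => hyt (T.collapse_mem_iff.1 (h ▸ T.collapse_mem_iff.2 hzt))
    rw [collapse, collapse, T.scale_of_notMem _ hyt, T.scale_of_notMem _ hzt] at h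
    exact Or.inl h.symm
  have hzt : z ∈ T.total := T.collapse_mem_iff.1 (h ▸ T.collapse_mem_iff.2 hyt)
  have hy1 : 1 ≤ T.radius y := not_lt.1 fun hlt => hy (T.mem_interiorN.2 ⟨hyt, hlt⟩)
  have hz1 : 1 ≤ T.radius z := not_lt.1 fun hlt => hz (T.mem_interiorN.2 ⟨hzt, hlt⟩)
  have hr : T.radius y = T.radius z := by
    have h' := congrArg T.radius h
    simp only [collapse, radius_scale_self, abs_of_nonneg (collapseFactor_nonneg _)] at h'
    exact strictMonoOn_collapseFactor_mul.injOn hy1 hz1 h'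
  rw [collapse, collapse, ← hr] at h
  -- At radius 1 the factor vanishes and only the base point survives, leaving `± v` in a line. At
  -- larger radius the factor is positive and the common scaling can be inverted.
  rcases hy1.eq_or_lt with h1 | h1
  · obtain ⟨⟨x, v⟩, rfl⟩ := hyt
    obtain ⟨⟨x', w⟩, rfl⟩ := hzt
    rw [scale_emb, scale_emb] at h
    obtain rfl : x = x' := congrArg Bundle.TotalSpace.proj (T.isOpenEmbedding_emb.injective h)
    rw [radius_emb, radius_emb] at hr
    rcases T.eq_or_eq_neg_of_norm_eq hr with rfl | rfl
    · exact Or.inl rfl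
    · right
      refine ⟨T.mem_boundaryN.2 ⟨T.emb_mem _, h1.symm⟩, ?_⟩
      rw [scale_emb, neg_smul, one_smul]
  · left
    have h2 := congrArg (T.scale (collapseFactor (T.radius y))⁻¹) h
    rw [scale_scale, scale_scale, inv_mul_cancel₀ (collapseFactor_pos h1).ne', scale_one,
      scale_one] at h2
    exact h2.symm

theorem exists_collapse_eq (q : Q) : ∃ y, y ∉ T.interiorN ∧ T.collapse y = q := by
  by_cases hq : q ∈ T.total
  swap
  · exact ⟨q, fun h => hq (T.mem_interiorN.1 h).1, T.scale_of_notMem _ hq⟩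
  obtain ⟨⟨x, v⟩, rfl⟩ := hq
  obtain ⟨r, hr, h⟩ := exists_collapseFactor_mul_eq (norm_nonneg v)
  have hr0 : 0 ≤ r := zero_le_one.trans hr
  -- On the zero section the direction `u` is arbitrary: either unit vector collapses to `x`.
  obtain ⟨u, hu, huv⟩ : ∃ u : T.E x, ‖u‖ = 1 ∧ v = ‖v‖ • u := by
    by_cases hv : v = 0
    · obtain ⟨u, hu⟩ := T.exists_norm_eq_one x
      exact ⟨u, hu, by simp [hv]⟩
    · exact ⟨‖v‖⁻¹ • v, by
        rw [norm_smul, norm_inv, norm_norm, inv_mul_cancel₀ (norm_ne_zero_iff.2 hv)], by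
        rw [smul_smul, mul_inv_cancel₀ (norm_ne_zero_iff.2 hv), one_smul]⟩
  have hn : ‖r • u‖ = r := by rw [norm_smul, hu, mul_one, Real.norm_of_nonneg hr0]
  refine ⟨T.emb ⟨x, r • u⟩, fun hy => ?_, ?_⟩
  · have := (T.mem_interiorN.1 hy).2
    rw [radius_emb, hn] at this
    exact this.not_ge hr
  · rw [collapse, radius_emb, scale_emb, hn, smul_smul, h, ← huv]

end LineTube

/-! ### Topology of glue-back spaces -/

/-- A Hausdorff criterion: the image of a normal `T₁` space under a closed continuous map. -/
theorem IsClosedMap.t2Space_of_surjective {X Y : Type*} [TopologicalSpace X] [TopologicalSpace Y]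
    [NormalSpace X] [T1Space X] {f : X → Y} (hf : IsClosedMap f) (hc : Continuous f)
    (hs : Function.Surjective f) : T2Space Y := by
  refine ⟨fun a b hab => ?_⟩
  have hcl : ∀ y : Y, IsClosed (f ⁻¹' {y}) := fun y => by
    obtain ⟨x, rfl⟩ := hs y
    refine IsClosed.preimage hc ?_
    rw [← Set.image_singleton]
    exact hf _ isClosed_singleton
  obtain ⟨U, V, hU, hV, haU, hbV, hUV⟩ := normal_separation (hcl a) (hcl b)
    ((Set.disjoint_singleton.2 hab).preimage f)
  -- The separating sets consist of the points whose whole fibre lies in `U`, respectively `V`; they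
  -- are open because `f` is closed.
  refine ⟨_, _, isClosedMap_iff_kernImage.1 hf hU, isClosedMap_iff_kernImage.1 hf hV,
    fun x hx => haU hx, fun x hx => hbV hx, Set.disjoint_left.2 fun y hyU hyV => ?_⟩
  obtain ⟨x, rfl⟩ := hs y
  exact Set.disjoint_left.1 hUV (hyU rfl) (hyV rfl)

section GlueBackTopology

variable {W : Type u} [TopologicalSpace W] {ι : Type} (P : InvolutivePanels W ι)
  {m : ℕ} (col : ι → Fin m → ZMod 2)

namespace GlueBack

theorem mk_surjective (p : GlueBack P col) : ∃ x g, mk P col x g = p := by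
  obtain ⟨⟨x, g⟩, rfl⟩ := Quot.exists_rep p
  exact ⟨x, g, rfl⟩

theorem mk_tau (i : ι) {x : W} (h : x ∈ P.panel i) (g : Fin m → ZMod 2) :
    mk P col (P.tau i ⟨x, h⟩) (g + col i) = mk P col x g :=
  (Quot.sound ⟨i, h, rfl, rfl⟩).symm

theorem add_add_color (g c : Fin m → ZMod 2) : g + c + c = g := by
  rw [add_assoc, (funext fun _ => CharTwo.add_self_eq_zero _ : c + c = 0), add_zero]

theorem isOpen_iff {U : Set (GlueBack P col)} :
    IsOpen U ↔ ∀ g, IsOpen ((fun x => mk P col x g) ⁻¹' U) := by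
  let : TopologicalSpace (Fin m → ZMod 2) := ⊥
  have : DiscreteTopology (Fin m → ZMod 2) := ⟨rfl⟩
  have h0 : IsOpen U ↔ IsOpen ((fun a : W × (Fin m → ZMod 2) => mk P col a.1 a.2) ⁻¹' U) :=
    isOpen_coinduced
  rw [h0]
  constructor
  · exact fun h g => h.preimage (Continuous.prodMk_left g)
  · intro h
    have : (fun a : W × (Fin m → ZMod 2) => mk P col a.1 a.2) ⁻¹' U =
        ⋃ g, ((fun x => mk P col x g) ⁻¹' U) ×ˢ {g} := by
      ext ⟨x, g⟩; simp
    rw [this]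
    exact isOpen_iUnion fun g => (h g).prod (isOpen_discrete _)

theorem isClosed_iff {C : Set (GlueBack P col)} :
    IsClosed C ↔ ∀ g, IsClosed ((fun x => mk P col x g) ⁻¹' C) := by
  simp only [← isOpen_compl_iff, isOpen_iff, Set.preimage_compl]

theorem continuous_mk (g : Fin m → ZMod 2) : Continuous fun x => mk P col x g :=
  ⟨fun _ hU => (isOpen_iff P col).1 hU g⟩

theorem continuous_of_comp_mk {Y : Type*} [TopologicalSpace Y] {f : GlueBack P col → Y}
    (h : ∀ g, Continuous fun x => f (mk P col x g)) : Continuous f :=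
  ⟨fun _ hU => (isOpen_iff P col).2 fun g => hU.preimage (h g)⟩

instance : ContinuousConstVAdd (Fin m → ZMod 2) (GlueBack P col) :=
  ⟨fun g => continuous_of_comp_mk P col fun g' => continuous_mk P col (g + g')⟩

instance [CompactSpace W] : CompactSpace (GlueBack P col) := by
  have h : (Set.univ : Set (GlueBack P col)) = ⋃ g, Set.range fun x => mk P col x g := by
    refine (Set.eq_univ_of_forall fun p => ?_).symm
    obtain ⟨x, g, rfl⟩ := mk_surjective P col p
    exact Set.mem_iUnion.2 ⟨g, x, rfl⟩
  exact ⟨h ▸ isCompact_iUnion fun g => isCompact_range (continuous_mk P col g)⟩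

/-- Membership in a family of sets stable under the gluing rule only depends on the class. -/
theorem mem_iff_of_mk_eq {B : (Fin m → ZMod 2) → Set W}
    (hB : ∀ i g x (h : x ∈ P.panel i), x ∈ B g → (P.tau i ⟨x, h⟩ : W) ∈ B (g + col i))
    {x y : W} {g g' : Fin m → ZMod 2} (h : mk P col x g = mk P col y g') :
    x ∈ B g ↔ y ∈ B g' := by
  refine iff_of_eq (congrArg (Quot.lift (fun a : W × (Fin m → ZMod 2) => a.1 ∈ B a.2) ?_) h)
  rintro ⟨x, g⟩ ⟨y, g'⟩ ⟨i, hx, rfl, rfl⟩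
  refine propext ⟨hB i g x hx, fun hy => ?_⟩
  have h1 := hB i _ _ (P.tau i ⟨x, hx⟩).2 hy
  rw [Subtype.coe_eta, P.tau_tau, add_add_color] at h1
  exact h1

/-- The saturation of a closed set under finitely many gluing rules is closed. -/
theorem exists_isClosed_saturation (hP : ∀ i, IsClosed (P.panel i))
    {A : (Fin m → ZMod 2) → Set W} (hA : ∀ g, IsClosed (A g)) (L : Finset ι) :
    ∃ B : (Fin m → ZMod 2) → Set W, (∀ g, IsClosed (B g)) ∧ (∀ g, A g ⊆ B g) ∧
      (∀ g, ∀ x ∈ B g, ∃ g', ∃ y ∈ A g', mk P col y g' = mk P col x g) ∧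
      ∀ i ∈ L, ∀ g x (h : x ∈ P.panel i), x ∈ B g → (P.tau i ⟨x, h⟩ : W) ∈ B (g + col i) := by
  classical
  induction L using Finset.induction_on with
  | empty => exact ⟨A, hA, fun _ => subset_rfl, fun g x hx => ⟨g, x, hx, rfl⟩, by simp⟩
  | insert i L _ ih =>
    obtain ⟨B, hcl, hAB, hBA, hL⟩ := ih
    -- Adjoin the points that rule `i` carries into `B`. Since `τ_i` commutes with the earlier `τ_j`
    -- and preserves their panels, stability under the earlier rules survives, so one pass per panel
    -- suffices.
    refine ⟨fun g => B g ∪ {x | ∃ h : x ∈ P.panel i, (P.tau i ⟨x, h⟩ : W) ∈ B (g + col i)},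
      fun g => (hcl g).union ?_, fun g => (hAB g).trans Set.subset_union_left, ?_, ?_⟩
    · have h1 : {x | ∃ h : x ∈ P.panel i, (P.tau i ⟨x, h⟩ : W) ∈ B (g + col i)} =
          ((↑) : P.panel i → W) '' ((fun x => (P.tau i x : W)) ⁻¹' B (g + col i)) := by
        ext x; simp
      rw [h1]
      exact (hP i).isClosedMap_subtype_val _
        ((hcl _).preimage (continuous_subtype_val.comp (P.tau i).continuous))
    · rintro g x (hx | ⟨h, hx⟩)
      · exact hBA g x hx
      · obtain ⟨g', y, hy, hyx⟩ := hBA _ _ hx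
        exact ⟨g', y, hy, hyx.trans (mk_tau P col i h g)⟩
    · rintro j hj g x h hx
      rcases Finset.mem_insert.1 hj with rfl | hj
      · rcases hx with hx | ⟨_, hx⟩
        · refine Or.inr ⟨(P.tau j ⟨x, h⟩).2, ?_⟩
          rw [Subtype.coe_eta, P.tau_tau, add_add_color]
          exact hx
        · exact Or.inl hx
      · rcases hx with hx | ⟨hi, hx⟩
        · exact Or.inl (hL j hj g x h hx)
        · refine Or.inr ⟨P.tau_mem j i ⟨x, h⟩ hi, ?_⟩
          rw [P.tau_comm i j x hi h, add_right_comm]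
          exact hL j hj _ _ _ hx

/-- This is closedness of the gluing map: with all rules used, the preimage of the image of `A` in
each sheet is exactly the saturation `B g`. -/
theorem isClosed_setOf_exists_mk [Finite ι] (hP : ∀ i, IsClosed (P.panel i))
    {A : (Fin m → ZMod 2) → Set W} (hA : ∀ g, IsClosed (A g)) :
    IsClosed {p | ∃ g, ∃ x ∈ A g, mk P col x g = p} := by
  cases nonempty_fintype ι
  obtain ⟨B, hcl, hAB, hBA, hB⟩ := exists_isClosed_saturation P col hP hA Finset.univ
  rw [isClosed_iff]
  intro g
  convert hcl g using 1
  ext x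
  refine ⟨fun ⟨g', y, hy, h⟩ => ?_, hBA g x⟩
  exact (mem_iff_of_mk_eq P col (fun i => hB i (Finset.mem_univ i)) h).1 (hAB g' hy)

theorem t2Space [Finite ι] [CompactSpace W] [T2Space W] (hP : ∀ i, IsClosed (P.panel i)) :
    T2Space (GlueBack P col) := by
  let : TopologicalSpace (Fin m → ZMod 2) := ⊥
  have : DiscreteTopology (Fin m → ZMod 2) := ⟨rfl⟩
  refine IsClosedMap.t2Space_of_surjective
    (f := fun a : W × (Fin m → ZMod 2) => mk P col a.1 a.2) (fun A hA => ?_)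
    continuous_coinduced_rng fun p => ?_
  · convert isClosed_setOf_exists_mk P col hP (A := fun g => (fun x => (x, g)) ⁻¹' A)
      (fun g => hA.preimage (Continuous.prodMk_left g)) using 1
    ext p
    constructor
    · rintro ⟨⟨x, g⟩, h, rfl⟩
      exact ⟨g, x, h, rfl⟩
    · rintro ⟨g, x, h, rfl⟩
      exact ⟨(x, g), h, rfl⟩
  · obtain ⟨x, g, rfl⟩ := mk_surjective P col p
    exact ⟨(x, g), rfl⟩

end GlueBack

end GlueBackTopology

namespace TubeSystem

variable {Q : Type u} [TopologicalSpace Q] {k : ℕ} {S : Fin k → Set Q} (T : TubeSystem S)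

/-! ### Scalings in compatible tubular neighbourhoods -/

/-- Compatibility gives one direction. Conversely, scale on to `0`; the total space of tube `j` is
open, so it also contains the `s`-multiple of `y` for some small `s ≠ 0`, and scaling by `s⁻¹`
returns to `y`. -/
theorem mem_total_scale_iff (i j : Fin k) (t : ℝ) (y : Q) :
    (T.tube i).scale t y ∈ (T.tube j).total ↔ y ∈ (T.tube j).total := by
  by_cases hy : y ∈ (T.tube i).total
  swap
  · rw [(T.tube i).scale_of_notMem t hy]
  rcases eq_or_ne i j with rfl | hij
  · exact (T.tube i).scale_mem_iff t
  refine ⟨fun h => ?_, fun h => T.scale_mem i j hij y ⟨hy, h⟩ t⟩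
  have h0 : (T.tube i).scale 0 y ∈ (T.tube j).total := by
    have := T.scale_mem i j hij _ ⟨(T.tube i).scale_mem t hy, h⟩ 0
    rwa [LineTube.scale_scale, zero_mul] at this
  obtain ⟨v, rfl⟩ := hy
  have hev := ((T.tube i).continuous_scale_emb v).continuousAt.eventually
    ((T.tube j).isOpen_total.mem_nhds h0)
  obtain ⟨s, hs, hs0⟩ := ((hev.filter_mono nhdsWithin_le_nhds).and
    (self_mem_nhdsWithin (a := (0 : ℝ)) (s := {0}ᶜ))).exists
  have h1 := T.scale_mem i j hij _ ⟨(T.tube i).scale_mem s ((T.tube i).emb_mem v), hs⟩ s⁻¹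
  rwa [LineTube.scale_scale, inv_mul_cancel₀ hs0, LineTube.scale_one] at h1

/-- The default values (radius 0, scaling the identity) make compatibility hold at every point of
`Q`, since scaling neither enters nor leaves another tube. -/
theorem radius_scale_of_ne {i j : Fin k} (hij : i ≠ j) (t : ℝ) (y : Q) :
    (T.tube j).radius ((T.tube i).scale t y) = (T.tube j).radius y := by
  by_cases hi : y ∈ (T.tube i).total
  swap
  · rw [(T.tube i).scale_of_notMem t hi]
  by_cases hj : y ∈ (T.tube j).total
  · exact T.radius_scale i j hij y ⟨hi, hj⟩ t
  · rw [LineTube.radius_of_notMem _ hj,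
      LineTube.radius_of_notMem _ fun h => hj ((T.mem_total_scale_iff i j t y).1 h)]

theorem scale_scale_comm (i j : Fin k) (s t : ℝ) (y : Q) :
    (T.tube i).scale s ((T.tube j).scale t y) = (T.tube j).scale t ((T.tube i).scale s y) := by
  rcases eq_or_ne i j with rfl | hij
  · rw [LineTube.scale_scale, LineTube.scale_scale, mul_comm]
  by_cases hi : y ∈ (T.tube i).total
  swap
  · rw [(T.tube i).scale_of_notMem s hi, (T.tube i).scale_of_notMem s fun h =>
      hi ((T.mem_total_scale_iff j i t y).1 h)]
  by_cases hj : y ∈ (T.tube j).total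
  · exact T.scale_comm i j hij y ⟨hi, hj⟩ s t
  · rw [(T.tube j).scale_of_notMem t hj, (T.tube j).scale_of_notMem t fun h =>
      hj ((T.mem_total_scale_iff i j s y).1 h)]

theorem radius_flip_eq (i j : Fin k) (y : Q) :
    (T.tube j).radius (T.flip i y) = (T.tube j).radius y := by
  rcases eq_or_ne i j with rfl | hij
  · exact (T.tube i).radius_neg y
  · exact T.radius_scale_of_ne hij _ y

theorem flip_mem_boundaryN_iff (i j : Fin k) (y : Q) :
    T.flip i y ∈ (T.tube j).boundaryN ↔ y ∈ (T.tube j).boundaryN := by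
  rw [LineTube.mem_boundaryN, LineTube.mem_boundaryN, radius_flip_eq, flip, mem_total_scale_iff]

theorem scale_zero_flip (i : Fin k) (y : Q) :
    (T.tube i).scale 0 (T.flip i y) = (T.tube i).scale 0 y := by
  rw [flip, LineTube.scale_scale, zero_mul]

/-! ### Freeness of the involutions -/

/-- Successive application of involutions. -/
noncomputable def flips (l : List (Fin k)) (y : Q) : Q := l.foldr T.flip y

theorem flips_flip_comm (l : List (Fin k)) (i : Fin k) (y : Q) :
    T.flips l (T.flip i y) = T.flip i (T.flips l y) := by
  induction l with
  | nil => rfl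
  | cons j l ih => exact (congrArg (T.flip j) ih).trans (T.scale_scale_comm j i _ _ _)

theorem flips_flips (l : List (Fin k)) (y : Q) : T.flips l (T.flips l y) = y := by
  induction l with
  | nil => rfl
  | cons j l ih =>
    change T.flip j (T.flips l (T.flip j (T.flips l y))) = y
    rw [flips_flip_comm, flip_flip, ih]

theorem flips_mem_boundaryN_iff (l : List (Fin k)) (j : Fin k) (y : Q) :
    T.flips l y ∈ (T.tube j).boundaryN ↔ y ∈ (T.tube j).boundaryN := by
  induction l with
  | nil => rfl
  | cons i l ih => exact (T.flip_mem_boundaryN_iff i j _).trans ih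

/-- Projection to the zero section in several tubular neighbourhoods. -/
noncomputable def project (L : List (Fin k)) (y : Q) : Q :=
  L.foldr (fun i => (T.tube i).scale 0) y

theorem project_flip (L : List (Fin k)) (i : Fin k) (y : Q) :
    T.project L (T.flip i y) = T.flip i (T.project L y) := by
  induction L with
  | nil => rfl
  | cons j L ih => exact (congrArg ((T.tube j).scale 0) ih).trans (T.scale_scale_comm j i _ _ _)

theorem project_flip_of_mem {L : List (Fin k)} {i : Fin k} (hi : i ∈ L) (y : Q) :
    T.project L (T.flip i y) = T.project L y := by
  induction L with
  | nil => simp at hi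
  | cons j L ih =>
    rcases List.mem_cons.1 hi with rfl | hi
    · exact (congrArg ((T.tube i).scale 0) (T.project_flip L i y)).trans (T.scale_zero_flip i _)
    · exact congrArg ((T.tube j).scale 0) (ih hi)

theorem project_mem_boundaryN_iff {L : List (Fin k)} {i : Fin k} (hi : i ∉ L) (y : Q) :
    T.project L y ∈ (T.tube i).boundaryN ↔ y ∈ (T.tube i).boundaryN := by
  induction L with
  | nil => rfl
  | cons j L ih =>
    rw [List.mem_cons, not_or] at hi
    refine Iff.trans ?_ (ih hi.2)
    change (T.tube j).scale 0 (T.project L y) ∈ _ ↔ _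
    rw [LineTube.mem_boundaryN, LineTube.mem_boundaryN, mem_total_scale_iff,
      T.radius_scale_of_ne (Ne.symm hi.1)]

/-- Flips in the tubes of `L` are absorbed by the projection, because scaling by 0 forgets the sign.
-/
theorem project_flips {L : List (Fin k)} {i : Fin k} (hL : ∀ j, j ≠ i → j ∈ L)
    (l : List (Fin k)) (y : Q) :
    T.project L (T.flips l y) = (T.flip i)^[l.count i] (T.project L y) := by
  induction l with
  | nil => rfl
  | cons j l ih =>
    change T.project L (T.flip j (T.flips l y)) = _
    rcases eq_or_ne j i with rfl | hj
    · rw [List.count_cons_self, Function.iterate_succ_apply', project_flip, ih]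
    · rw [List.count_cons_of_ne hj, T.project_flip_of_mem (hL j hj), ih]

/-- Project to the zero section of all other tubes. The image of `y` stays on the sphere bundle of
tube `i`, where an odd power of the flip has no fixed point. -/
theorem even_count_of_flips_eq {l : List (Fin k)} {y : Q} (h : T.flips l y = y)
    (hl : ∀ i ∈ l, y ∈ (T.tube i).boundaryN) (i : Fin k) : Even (l.count i) := by
  by_contra hodd
  rw [Nat.not_even_iff_odd] at hodd
  have hi : y ∈ (T.tube i).boundaryN := hl i (List.count_pos_iff.1 hodd.pos)
  let L := (List.finRange k).filter (· ≠ i)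
  have h1 := T.project_flips (L := L) (i := i) (fun j hj => by simp [L, hj]) l y
  rw [h, (show Function.Involutive (T.flip i) from T.flip_flip i).iterate_odd hodd] at h1
  exact (T.tube i).scale_neg_ne ((T.project_mem_boundaryN_iff (L := L) (by simp [L]) y).2 hi) h1.symm

/-- Every flip preserves all sphere bundles, so the panel condition can be read at the starting
point `x`. A word is its own inverse, both on points and on colours, which handles symmetry. -/
theorem exists_flips_of_mk_eq {m : ℕ} (col : Fin k → Fin m → ZMod 2) {x y : T.core}
    {g g' : Fin m → ZMod 2}
    (h : GlueBack.mk T.panels col x g = GlueBack.mk T.panels col y g') :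
    ∃ l : List (Fin k), (∀ i ∈ l, (x : Q) ∈ (T.tube i).boundaryN) ∧
      (y : Q) = T.flips l x ∧ g' = g + (l.map col).sum := by
  suffices ∀ a b : T.core × (Fin m → ZMod 2), Relation.EqvGen (GlueBackRel T.panels col) a b →
      ∃ l : List (Fin k), (∀ i ∈ l, (a.1 : Q) ∈ (T.tube i).boundaryN) ∧
        (b.1 : Q) = T.flips l a.1 ∧ b.2 = a.2 + (l.map col).sum from
    this _ _ (Quot.eqvGen_exact h)
  intro a b hab
  induction hab with
  | rel a b h =>
    obtain ⟨i, hi, h1, h2⟩ := h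
    refine ⟨[i], fun j hj => ?_, congrArg Subtype.val h1, by simpa using h2⟩
    rw [List.mem_singleton.1 hj]
    exact hi
  | refl a => exact ⟨[], by simp, rfl, by simp⟩
  | symm a b _ ih =>
    obtain ⟨l, hl, h1, h2⟩ := ih
    refine ⟨l, fun i hi => ?_, ?_, ?_⟩
    · rw [h1, flips_mem_boundaryN_iff]; exact hl i hi
    · rw [h1, flips_flips]
    · rw [h2, GlueBack.add_add_color]
  | trans a b c _ _ ih ih' =>
    obtain ⟨l, hl, h1, h2⟩ := ih
    obtain ⟨l', hl', h1', h2'⟩ := ih'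
    refine ⟨l' ++ l, fun i hi => ?_, ?_, ?_⟩
    · rcases List.mem_append.1 hi with hi | hi
      · have := hl' i hi
        rwa [h1, flips_mem_boundaryN_iff] at this
      · exact hl i hi
    · rw [h1', h1, flips, flips, flips, List.foldr_append]
    · rw [h2', h2, List.map_append, List.sum_append, add_assoc, add_comm (l.map col).sum]

theorem mk_injective {m : ℕ} (col : Fin k → Fin m → ZMod 2) (x : T.core) :
    Function.Injective fun g => GlueBack.mk T.panels col x g := by
  intro g g' h
  obtain ⟨l, hl, h1, h2⟩ := T.exists_flips_of_mk_eq col h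
  have h3 : (l.map col).sum = 0 := by
    rw [Finset.sum_list_map_count]
    refine Finset.sum_eq_zero fun i _ => ?_
    obtain ⟨c, hc⟩ := T.even_count_of_flips_eq h1.symm hl i
    rw [hc]
    funext a
    rw [Pi.smul_apply, add_smul, CharTwo.add_self_eq_zero, Pi.zero_apply]
  rw [h2, h3, add_zero]

/-! ### The collapse of the core -/

theorem collapse_flip (i j : Fin k) (y : Q) :
    (T.tube j).collapse (T.flip i y) = T.flip i ((T.tube j).collapse y) := by
  rw [LineTube.collapse, radius_flip_eq]
  exact T.scale_scale_comm j i _ _ y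

theorem collapse_flip_of_mem_boundaryN {i : Fin k} {y : Q} (hy : y ∈ (T.tube i).boundaryN) :
    (T.tube i).collapse (T.flip i y) = (T.tube i).collapse y := by
  have h := ((T.tube i).mem_boundaryN.1 hy).2
  rw [LineTube.collapse, LineTube.collapse, radius_flip_eq, h, LineTube.collapseFactor_one,
    scale_zero_flip]

/-- Successive collapse of tubular neighbourhoods. -/
noncomputable def collapses (l : List (Fin k)) (y : Q) : Q :=
  l.foldr (fun i => (T.tube i).collapse) y

theorem mem_total_collapses_iff (l : List (Fin k)) (j : Fin k) (y : Q) :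
    T.collapses l y ∈ (T.tube j).total ↔ y ∈ (T.tube j).total := by
  induction l with
  | nil => rfl
  | cons i l ih => exact (T.mem_total_scale_iff i j _ _).trans ih

theorem radius_collapses {l : List (Fin k)} {j : Fin k} (hj : j ∉ l) (y : Q) :
    (T.tube j).radius (T.collapses l y) = (T.tube j).radius y := by
  induction l with
  | nil => rfl
  | cons i l ih =>
    rw [List.mem_cons, not_or] at hj
    exact (T.radius_scale_of_ne (Ne.symm hj.1) _ _).trans (ih hj.2)

theorem collapses_mem_interiorN_iff {l : List (Fin k)} {j : Fin k} (hj : j ∉ l) (y : Q) :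
    T.collapses l y ∈ (T.tube j).interiorN ↔ y ∈ (T.tube j).interiorN := by
  rw [LineTube.mem_interiorN, LineTube.mem_interiorN, mem_total_collapses_iff,
    T.radius_collapses hj]

theorem collapses_mem_boundaryN_iff {l : List (Fin k)} {j : Fin k} (hj : j ∉ l) (y : Q) :
    T.collapses l y ∈ (T.tube j).boundaryN ↔ y ∈ (T.tube j).boundaryN := by
  rw [LineTube.mem_boundaryN, LineTube.mem_boundaryN, mem_total_collapses_iff,
    T.radius_collapses hj]

theorem collapses_flip (l : List (Fin k)) (i : Fin k) (y : Q) :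
    T.collapses l (T.flip i y) = T.flip i (T.collapses l y) := by
  induction l with
  | nil => rfl
  | cons j l ih => exact (congrArg (T.tube j).collapse ih).trans (T.collapse_flip i j _)

/-- The flip commutes with the collapses applied before the `i`-th. Without repetitions these keep
the radius in tube `i` equal to 1, so the `i`-th collapse then identifies the two points. -/
theorem collapses_flip_of_mem {l : List (Fin k)} (hl : l.Nodup) {i : Fin k} (hi : i ∈ l) {y : Q}
    (hy : y ∈ (T.tube i).boundaryN) : T.collapses l (T.flip i y) = T.collapses l y := by
  induction l with
  | nil => simp at hi
  | cons j l ih =>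
    rw [List.nodup_cons] at hl
    rcases List.mem_cons.1 hi with rfl | hi
    · refine (congrArg (T.tube i).collapse (T.collapses_flip l i y)).trans ?_
      exact T.collapse_flip_of_mem_boundaryN ((T.collapses_mem_boundaryN_iff hl.1 y).2 hy)
    · exact congrArg (T.tube j).collapse (ih hl.2 hi)

theorem continuous_collapses [T2Space Q] [∀ i, CompactSpace (S i)] (l : List (Fin k)) :
    Continuous (T.collapses l) := by
  induction l with
  | nil => exact continuous_id
  | cons i l ih => exact (T.tube i).continuous_collapse.comp ih

theorem exists_collapses_eq {l : List (Fin k)} (hl : l.Nodup) (q : Q) :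
    ∃ y, T.collapses l y = q ∧ ∀ i ∈ l, y ∉ (T.tube i).interiorN := by
  induction l generalizing q with
  | nil => exact ⟨q, rfl, by simp⟩
  | cons i l ih =>
    rw [List.nodup_cons] at hl
    obtain ⟨w, hw, rfl⟩ := (T.tube i).exists_collapse_eq q
    obtain ⟨y, rfl, hy⟩ := ih hl.2 w
    refine ⟨y, rfl, fun j hj => ?_⟩
    rcases List.mem_cons.1 hj with rfl | hj
    · exact fun h => hw ((T.collapses_mem_interiorN_iff hl.1 y).2 h)
    · exact hy j hj

theorem notMem_interiorN_of_mem_core {y : Q} (hy : y ∈ T.core) (i : Fin k) :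
    y ∉ (T.tube i).interiorN := fun h => hy (Set.mem_iUnion.2 ⟨i, h⟩)

/-! ### The projection of the glue-back space onto `Q` -/

section

variable {m : ℕ} (col : Fin k → Fin m → ZMod 2)

/-- Points of the core with the same collapse have the same orbit in the glue-back space. -/
theorem exists_mk_eq_of_collapses_eq {l : List (Fin k)} (hl : l.Nodup) {x y : T.core}
    (h : T.collapses l x = T.collapses l y) (g : Fin m → ZMod 2) :
    ∃ g', GlueBack.mk T.panels col x g = GlueBack.mk T.panels col y g' := by
  induction l generalizing x g with
  | nil => exact ⟨g, by rw [Subtype.ext h]⟩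
  | cons i l ih =>
    rw [List.nodup_cons] at hl
    rcases (T.tube i).eq_or_eq_of_collapse_eq
      (fun hx => T.notMem_interiorN_of_mem_core x.2 i ((T.collapses_mem_interiorN_iff hl.1 _).1 hx))
      (fun hy => T.notMem_interiorN_of_mem_core y.2 i ((T.collapses_mem_interiorN_iff hl.1 _).1 hy))
      h with h1 | ⟨h1, h2⟩
    · exact ih hl.2 h1.symm g
    -- Replacing `(x, g)` by its glued partner `(τ_i x, g + col i)` makes the remaining collapses
    -- agree.
    · have hx : x ∈ T.panels.panel i := (T.collapses_mem_boundaryN_iff hl.1 _).1 h1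
      obtain ⟨g', hg'⟩ := ih hl.2 (x := T.panels.tau i ⟨x, hx⟩)
        (h2.trans (T.collapses_flip l i x).symm).symm (g + col i)
      exact ⟨g', (GlueBack.mk_tau T.panels col i hx g).symm.trans hg'⟩

/-- The map from the glue-back space onto `Q` induced by the collapse of the core. -/
noncomputable def projection : GlueBack T.panels col → Q :=
  Quot.lift (fun a => T.collapses (List.finRange k) a.1) (by
    rintro ⟨x, g⟩ ⟨y, g'⟩ ⟨i, hx, rfl, rfl⟩
    exact (T.collapses_flip_of_mem (List.nodup_finRange k) (List.mem_finRange i) hx).symm)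

theorem continuous_projection [T2Space Q] [∀ i, CompactSpace (S i)] :
    Continuous (T.projection col) :=
  GlueBack.continuous_of_comp_mk T.panels col fun _ =>
    (T.continuous_collapses _).comp continuous_subtype_val

theorem projection_surjective : Function.Surjective (T.projection col) := fun q => by
  obtain ⟨y, hy, h⟩ := T.exists_collapses_eq (List.nodup_finRange k) q
  exact ⟨GlueBack.mk T.panels col ⟨y, fun hy => by
    obtain ⟨i, hi⟩ := Set.mem_iUnion.1 hy
    exact h i (List.mem_finRange i) hi⟩ 0, hy⟩

/-- The projection ignores the group coordinate, and equal collapses allow both points to be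
represented over the same point of the core. -/
theorem projection_eq_iff {p q : GlueBack T.panels col} :
    T.projection col p = T.projection col q ↔ p ∈ AddAction.orbit (Fin m → ZMod 2) q := by
  obtain ⟨x, g, rfl⟩ := GlueBack.mk_surjective _ _ p
  obtain ⟨y, g', rfl⟩ := GlueBack.mk_surjective _ _ q
  constructor
  · intro h
    obtain ⟨c, hc⟩ := T.exists_mk_eq_of_collapses_eq col (List.nodup_finRange k) h g
    exact ⟨c - g', by rw [hc]; simp only [GlueBack.vadd_mk, sub_add_cancel]⟩
  · rintro ⟨c, hc⟩
    rw [← hc]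
    rfl

theorem vadd_ne {g : Fin m → ZMod 2} (hg : g ≠ 0) (p : GlueBack T.panels col) : g +ᵥ p ≠ p := by
  obtain ⟨x, g₀, rfl⟩ := GlueBack.mk_surjective _ _ p
  rw [GlueBack.vadd_mk]
  exact fun h => hg (add_eq_right.1 (T.mk_injective col x h))

instance [CompactSpace Q] : CompactSpace T.core :=
  isCompact_iff_compactSpace.1
    (isOpen_iUnion fun i => (T.tube i).isOpen_interiorN).isClosed_compl.isCompact

theorem t2Space_glueBack [T2Space Q] [CompactSpace Q] [∀ i, CompactSpace (S i)] :
    T2Space (GlueBack T.panels col) :=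
  GlueBack.t2Space T.panels col fun i =>
    (T.tube i).isClosed_boundaryN.preimage continuous_subtype_val

/-- The orbit space of the glue-back space is homeomorphic to `Q`. -/
noncomputable def orbitHomeomorph [T2Space Q] [CompactSpace Q] [∀ i, CompactSpace (S i)] :
    AddAction.orbitRel.Quotient (Fin m → ZMod 2) (GlueBack T.panels col) ≃ₜ Q :=
  Continuous.homeoOfEquivCompactToT2
    (f := Equiv.ofBijective
      (Quotient.lift (T.projection col) fun _ _ h => (T.projection_eq_iff col).2 h)
      ⟨by
        rintro ⟨p⟩ ⟨q⟩ h
        exact Quotient.sound ((T.projection_eq_iff col).1 h),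
      fun q => by
        obtain ⟨p, rfl⟩ := T.projection_surjective col q
        exact ⟨Quotient.mk _ p, rfl⟩⟩)
    ((T.continuous_projection col).quotient_lift _)

/-- The projection is a quotient map, being closed from a compact to a Hausdorff space. Its fibres
are the orbits of a free action that is properly discontinuous because the group is finite, so it is
a covering. -/
theorem isLocalHomeomorph_projection [T2Space Q] [CompactSpace Q] [∀ i, CompactSpace (S i)] :
    IsLocalHomeomorph (T.projection col) := by
  have := T.t2Space_glueBack col
  have hq : Topology.IsQuotientMap (T.projection col) :=
    (T.continuous_projection col).isClosedMap.isQuotientMap (T.continuous_projection col)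
      (T.projection_surjective col)
  have : IsCancelVAdd (Fin m → ZMod 2) (GlueBack T.panels col) :=
    isCancelVAdd_iff_eq_zero_of_vadd_eq.2 fun g p h => by
      by_contra hg
      exact T.vadd_ne col hg p h
  have : ProperlyDiscontinuousVAdd (Fin m → ZMod 2) (GlueBack T.panels col) :=
    ⟨fun _ _ => Set.toFinite _⟩
  exact (hq.isAddQuotientCoveringMap_of_properlyDiscontinuousVAdd
    (T.projection_eq_iff col)).isCoveringMap.isLocalHomeomorph

end

end TubeSystem

theorem mainTheorem10 {n k m : ℕ} {Q : Type u} [TopologicalSpace Q] [T2Space Q] [CompactSpace Q]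
    [ConnectedSpace Q] [ChartedSpace (EuclideanSpace ℝ (Fin n)) Q] [IsManifold (𝓡 n) ∞ Q]
    (S : Fin k → Set Q) (hS : IsZ2CutSystem n S) (T : TubeSystem S)
    (col : Fin k → Fin m → ZMod 2) :
    -- the glue-back space is a compact Hausdorff second countable space
    CompactSpace (GlueBack T.panels col) ∧ T2Space (GlueBack T.panels col) ∧
    SecondCountableTopology (GlueBack T.panels col) ∧
    -- the natural action is free
    (∀ g : Fin m → ZMod 2, g ≠ 0 → ∀ p : GlueBack T.panels col, g +ᵥ p ≠ p) ∧
    -- its orbit space is homeomorphic to `Q`, and the glue-back space is a smooth `n`-manifold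
    -- without boundary on which the group acts smoothly, with smooth orbit map
    ∃ h : AddAction.orbitRel.Quotient (Fin m → ZMod 2) (GlueBack T.panels col) ≃ₜ Q,
      ∃ _ : ChartedSpace (EuclideanSpace ℝ (Fin n)) (GlueBack T.panels col),
        IsManifold (𝓡 n) ∞ (GlueBack T.panels col) ∧
        (∀ g : Fin m → ZMod 2,
          ContMDiff (𝓡 n) (𝓡 n) ∞ (fun p : GlueBack T.panels col => g +ᵥ p)) ∧
        IsLocalDiffeomorph (𝓡 n) (𝓡 n) ∞
          (fun p : GlueBack T.panels col => h (Quotient.mk _ p)) := by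
  have hcs : ∀ i, CompactSpace (S i) := fun i =>
    isCompact_iff_compactSpace.1 (hS.generalPosition.1 i).isCompact
  have hloc := T.isLocalHomeomorph_projection col
  let := hloc.pullbackChartedSpace (H := EuclideanSpace ℝ (Fin n))
  have hdiff := hloc.isLocalDiffeomorph_pullback (𝓡 n) ∞
  -- `orbitHomeomorph` is the descent of `projection`, so the composite in the last conjunct unfolds
  -- to `T.projection col` and `hdiff` applies.
  refine ⟨inferInstance, T.t2Space_glueBack col,
    ChartedSpace.secondCountable_of_sigmaCompact (EuclideanSpace ℝ (Fin n)) _,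
    fun g hg p => T.vadd_ne col hg p, T.orbitHomeomorph col, inferInstance,
    hloc.isManifold_pullback (𝓡 n) ∞, fun g => ?_, hdiff⟩
  -- The translation by `g` is a continuous lift of the projection through itself.
  refine hdiff.contMDiff_of_comp (continuous_const_vadd g) ?_
  convert hdiff.contMDiff using 1
  funext p
  exact (T.projection_eq_iff col).2 ⟨g, rfl⟩
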